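/- Write $(a;q)_m=\prod_{j=0}^{m-1}(1-aq^j)$, $(a;q)_\infty=\prod_{j=0}^{\infty}(1-aq^j)$ and $(a_1,a_2,a_3;q)_\infty=(a_1;q)_\infty(a_2;q)_\infty(a_3;q)_\infty$. Then $$\sum_{n,r\ge 0}\frac{(-1)^n q^{\frac52 n^2-\frac12 n+4nr+2r^2}\,(q;q)_{n+r}\,(q;q)_{n+2r}\,(q;q)_{2n+3r}}{(q^3;q^3)_{n+r}\,(q^3;q^3)_{n+2r}\,(q;q)_n\,(q;q)_r\,(q;q)_{2n+2r}}=\frac{(q^3,q^4,q^7;q^7)_\infty}{(q^3;q^3)_\infty}.$$ This holds for every complex $q$ with $|q|<1$, where the double series converges absolutely, and it also holds as an identity of formal power series in $\mathbb Z[[q]]$, where the double series converges coefficientwise. -/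

import Mathlib

open scoped PowerSeries PowerSeries.WithPiTopology

/-- The finite `q`-Pochhammer symbol `(a; q)_m = ∏_{j=0}^{m-1} (1 - a q^j)`. -/
def qPoch {R : Type*} [CommRing R] (a q : R) (m : ℕ) : R :=
  ∏ j ∈ Finset.range m, (1 - a * q ^ j)

/-- The infinite `q`-Pochhammer symbol `(a; q)_∞ = ∏_{j≥0} (1 - a q^j)`, for a commutative ring
with a topology. -/
noncomputable def qPochInf {R : Type*} [CommRing R] [TopologicalSpace R] (a q : R) : R :=
  ∏' j : ℕ, (1 - a * q ^ j)

/-- The exponent `(5/2) n² - (1/2) n + 4 n r + 2 r²`. The subtraction and the division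
by two are exact, see `two_mul_rrExponent`. -/
def rrExponent (n r : ℕ) : ℕ := (5 * n ^ 2 - n) / 2 + 4 * n * r + 2 * r ^ 2

theorem two_mul_rrExponent (n r : ℕ) :
    2 * (rrExponent n r : ℤ) = 5 * (n : ℤ) ^ 2 - n + 8 * n * r + 4 * r ^ 2 := by
  have h1 : n ≤ 5 * n ^ 2 := by nlinarith [Nat.le_self_pow (two_ne_zero) n]
  have h2 : 2 ∣ 5 * n ^ 2 - n := by
    have h : Even (5 * n ^ 2 - n) := by
      rw [Nat.even_sub h1]
      simp [Nat.even_mul, Nat.even_pow, show ¬ Even 5 by decide]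
    exact h.two_dvd
  obtain ⟨c, hc⟩ := h2
  have h3 : (5 * n ^ 2 - n) / 2 = c := by omega
  have h4 : 2 * c + n = 5 * n ^ 2 := by omega
  have h5 : 2 * (c : ℤ) + n = 5 * (n : ℤ) ^ 2 := by exact_mod_cast h4
  unfold rrExponent
  rw [h3]
  push_cast
  linarith

/-- The numerator
`(-1)^n q^{5n²/2 - n/2 + 4nr + 2r²} (q;q)_{n+r} (q;q)_{n+2r} (q;q)_{2n+3r}`. -/
def rrNum {R : Type*} [CommRing R] (q : R) (n r : ℕ) : R :=
  (-1) ^ n * q ^ rrExponent n r *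
    (qPoch q q (n + r) * qPoch q q (n + 2 * r) * qPoch q q (2 * n + 3 * r))

/-- The denominator
`(q³;q³)_{n+r} (q³;q³)_{n+2r} (q;q)_n (q;q)_r (q;q)_{2n+2r}`. -/
def rrDen {R : Type*} [CommRing R] (q : R) (n r : ℕ) : R :=
  qPoch (q ^ 3) (q ^ 3) (n + r) * qPoch (q ^ 3) (q ^ 3) (n + 2 * r) *
    (qPoch q q n * qPoch q q r * qPoch q q (2 * n + 2 * r))

/-- The product `(q³, q⁴, q⁷; q⁷)_∞ = (q³;q⁷)_∞ (q⁴;q⁷)_∞ (q⁷;q⁷)_∞`. -/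
noncomputable def rrProd {R : Type*} [CommRing R] [TopologicalSpace R] (q : R) : R :=
  qPochInf (q ^ 3) (q ^ 7) * qPochInf (q ^ 4) (q ^ 7) * qPochInf (q ^ 7) (q ^ 7)

/-! ### Finite q-Vandermonde sums and the Bailey kernel. -/

section Finite

variable {K : Type*} [Field K]

/-! Write m = n + r, Q_n = (q³;q³)_n / (q;q)_n (`qPochCubic`), a_k for `unitCoeff` and K_q(m,k) for
`baileyKernel`. For fixed m the summand contains (q;q)_{2m+r} / ((q;q)_{2m} (q;q)_r Q_m Q_{m+r}),
which `sum_unitCoeff_cubic` expands as ∑_k a_k q^{k²} K_q(r,k) / (Q_{m-k} Q_{m+k}). The remaining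
alternating sum over r turns q^{k²} K_q(r,k) into q^{m²} K_q(m,k) (`sum_baileyKernel_alternating`),
and the factors Q change the base of the kernel from q to q³. Hence the terms with n + r = m add up
to q^{3m²} ∑_k a_k K_{q³}(m,k) (`sum_antidiagonal_rr`).

Bailey's lemma in base q³ (`sum_baileyKernel_durfee`), with weights 1/(q³;q³)_{M-m}, gives ∑_k a_k
q^{3k²} K_{q³}(M,k). Letting M → ∞ and cancelling one factor 1/(q³;q³)_∞, the double sum equals ∑_k
a_k q^{3k²} / (q³;q³)_∞. This theta series is the required product by the Jacobi triple product in
base q⁷ (`tsum_unitCoeff`).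

The finite identities are proved in a field and descend to a domain through its fraction field. The
limits use only `IsConvergentBase`, so one argument (`IsConvergentBase.hasSum_rr`) serves both
complex q and the formal variable; compact sets play the role of bounded ones. -/

theorem qPoch_succ {R : Type*} [CommRing R] (a q : R) (n : ℕ) :
    qPoch a q (n + 1) = qPoch a q n * (1 - a * q ^ n) := by
  simp [qPoch, Finset.prod_range_succ]

@[simp] theorem qPoch_zero {R : Type*} [CommRing R] (a q : R) : qPoch a q 0 = 1 := by
  simp [qPoch]

theorem qPoch_self_succ {R : Type*} [CommRing R] (q : R) (n : ℕ) :
    qPoch q q (n + 1) = qPoch q q n * (1 - q ^ (n + 1)) := by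
  rw [qPoch_succ, pow_succ' q n]

theorem qPoch_self_ne_zero {q : K} (hq : ∀ n : ℕ, 1 - q ^ (n + 1) ≠ 0) (n : ℕ) :
    qPoch q q n ≠ 0 := by
  induction n with
  | zero => simp
  | succ n ih => rw [qPoch_self_succ]; exact mul_ne_zero ih (hq n)

/-- A terminating form of the `q`-Vandermonde sum (finite Durfee square identity). -/
theorem sum_durfee {q : K} (hq : ∀ n : ℕ, 1 - q ^ (n + 1) ≠ 0) (S c : ℕ) :
    ∑ s ∈ Finset.range (S + 1),
      q ^ (s ^ 2 + c * s) * (qPoch q q s * qPoch q q (S - s) * qPoch q q (s + c))⁻¹ =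
      (qPoch q q S * qPoch q q (S + c))⁻¹ := by
  have hp := qPoch_self_ne_zero hq
  induction S generalizing c with
  | zero => simp
  | succ S ih =>
    refine mul_left_cancel₀ (hq S) ?_
    have h1 : (1 - q ^ (S + 1)) * (qPoch q q (S + 1) * qPoch q q (S + 1 + c))⁻¹ =
        (qPoch q q S * qPoch q q (S + (c + 1)))⁻¹ := by
      rw [show S + (c + 1) = S + 1 + c by ring, qPoch_self_succ q S]
      have := hp S; have := hp (S + 1 + c); have := hq S
      field_simp
    rw [h1, ← ih (c + 1), Finset.mul_sum]
    -- Split 1 - q^{S+1} = (1 - q^s) + q^s (1 - q^{S+1-s}). The first part vanishes at s = 0, the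
    -- second at s = S + 1; after shifting the first they combine termwise into the case (S, c + 1).
    have h2 : ∀ s ∈ Finset.range (S + 1 + 1), (1 - q ^ (S + 1)) * (q ^ (s ^ 2 + c * s) *
        (qPoch q q s * qPoch q q (S + 1 - s) * qPoch q q (s + c))⁻¹) =
        (1 - q ^ s) * (q ^ (s ^ 2 + c * s) *
        (qPoch q q s * qPoch q q (S + 1 - s) * qPoch q q (s + c))⁻¹) +
        q ^ s * (1 - q ^ (S + 1 - s)) * (q ^ (s ^ 2 + c * s) *
        (qPoch q q s * qPoch q q (S + 1 - s) * qPoch q q (s + c))⁻¹) := by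
      intro s hs
      obtain ⟨d, hd⟩ := Nat.exists_eq_add_of_le (Finset.mem_range_succ_iff.1 hs)
      rw [hd, Nat.add_sub_cancel_left]
      ring
    rw [Finset.sum_congr rfl h2, Finset.sum_add_distrib, Finset.sum_range_succ',
      Finset.sum_range_succ (n := S + 1)]
    simp only [Nat.sub_self, pow_zero, sub_self, zero_mul, add_zero, mul_zero]
    rw [← Finset.sum_add_distrib]
    refine Finset.sum_congr rfl fun s hs => ?_
    obtain ⟨d, rfl⟩ := Nat.exists_eq_add_of_le (Finset.mem_range_succ_iff.1 hs)
    rw [show s + d + 1 - (s + 1) = d by omega, show s + d + 1 - s = d + 1 by omega,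
      show s + d - s = d by omega, show s + 1 + c = s + c + 1 by ring,
      show s + (c + 1) = s + c + 1 by ring, qPoch_self_succ q s, qPoch_self_succ q d,
      qPoch_self_succ q (s + c)]
    have := hp s; have := hp d; have := hp (s + c)
    have := hq s; have := hq d; have := hq (s + c)
    field_simp
    ring

/-- The inverse-base form of the terminating `q`-Vandermonde sum. -/
theorem sum_alternating_vandermonde {q : K} (hq : ∀ n : ℕ, 1 - q ^ (n + 1) ≠ 0) (N c : ℕ) :
    ∑ i ∈ Finset.range (N + 1), (-1) ^ i * q ^ (i.choose 2) *
      (qPoch q q i * qPoch q q (N - i) * qPoch q q (N - i + c))⁻¹ =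
      q ^ (N ^ 2 + N * c) * (qPoch q q N * qPoch q q (N + c))⁻¹ := by
  have hp := qPoch_self_ne_zero hq
  induction N generalizing c with
  | zero => simp
  | succ N ih =>
    refine mul_left_cancel₀ (hq N) ?_
    have h1 : (1 - q ^ (N + 1)) * (q ^ ((N + 1) ^ 2 + (N + 1) * c) *
        (qPoch q q (N + 1) * qPoch q q (N + 1 + c))⁻¹) =
        q ^ (N + 1 + c) * (q ^ (N ^ 2 + N * (c + 1)) *
          (qPoch q q N * qPoch q q (N + (c + 1)))⁻¹) := by
      rw [show N + (c + 1) = N + 1 + c by ring, qPoch_self_succ q N]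
      have := hp N; have := hp (N + 1 + c); have := hq N
      field_simp
      ring
    rw [h1, ← ih (c + 1), Finset.mul_sum, Finset.mul_sum]
    -- The same splitting of 1 - q^{N+1} leads to the case (N, c + 1).
    have h2 : ∀ s ∈ Finset.range (N + 1 + 1), (1 - q ^ (N + 1)) * ((-1) ^ s * q ^ (s.choose 2) *
        (qPoch q q s * qPoch q q (N + 1 - s) * qPoch q q (N + 1 - s + c))⁻¹) =
        (1 - q ^ s) * ((-1) ^ s * q ^ (s.choose 2) *
        (qPoch q q s * qPoch q q (N + 1 - s) * qPoch q q (N + 1 - s + c))⁻¹) +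
        q ^ s * (1 - q ^ (N + 1 - s)) * ((-1) ^ s * q ^ (s.choose 2) *
        (qPoch q q s * qPoch q q (N + 1 - s) * qPoch q q (N + 1 - s + c))⁻¹) := by
      intro s hs
      obtain ⟨d, hd⟩ := Nat.exists_eq_add_of_le (Finset.mem_range_succ_iff.1 hs)
      rw [hd, Nat.add_sub_cancel_left]
      ring
    rw [Finset.sum_congr rfl h2, Finset.sum_add_distrib, Finset.sum_range_succ',
      Finset.sum_range_succ (n := N + 1)]
    simp only [Nat.sub_self, pow_zero, sub_self, zero_mul, add_zero, mul_zero]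
    rw [← Finset.sum_add_distrib]
    refine Finset.sum_congr rfl fun s hs => ?_
    obtain ⟨d, rfl⟩ := Nat.exists_eq_add_of_le (Finset.mem_range_succ_iff.1 hs)
    rw [show s + d + 1 - (s + 1) = d by omega, show s + d + 1 - s = d + 1 by omega,
      show s + d - s = d by omega, show d + 1 + c = d + c + 1 by ring,
      show d + (c + 1) = d + c + 1 by ring, qPoch_self_succ q s, qPoch_self_succ q d,
      qPoch_self_succ q (d + c), Nat.choose_succ_succ' s 1, Nat.choose_one_right]
    have := hp s; have := hp d; have := hp (d + c)
    have := hq s; have := hq d; have := hq (d + c)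
    field_simp
    ring

/-- The kernel `1 / ((q; q)_{m-k} (q; q)_{m+k})` of a Bailey pair, zero for `k > m`. -/
noncomputable def baileyKernel {R : Type*} [CommRing R] (q : R) (m k : ℕ) : R :=
  if k ≤ m then Ring.inverse (qPoch q q (m - k)) * Ring.inverse (qPoch q q (m + k)) else 0

theorem baileyKernel_of_lt {R : Type*} [CommRing R] (q : R) {m k : ℕ} (h : m < k) :
    baileyKernel q m k = 0 := if_neg (by omega)

theorem baileyKernel_add (q : K) (k i : ℕ) :
    baileyKernel q (k + i) k = (qPoch q q i * qPoch q q (2 * k + i))⁻¹ := by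
  rw [baileyKernel, if_pos (by omega), Nat.add_sub_cancel_left,
    show k + i + k = 2 * k + i by ring]
  simp [mul_comm]

theorem baileyKernel_eq_mul_succ {q : K} (hq : ∀ n : ℕ, 1 - q ^ (n + 1) ≠ 0) (k i : ℕ) :
    baileyKernel q (k + i) k =
      (1 - q ^ (i + 1)) * (1 - q ^ (2 * k + i + 1)) * baileyKernel q (k + i + 1) k := by
  rw [add_assoc k i 1, baileyKernel_add, baileyKernel_add, ← add_assoc, qPoch_self_succ q i,
    qPoch_self_succ q (2 * k + i)]
  have := qPoch_self_ne_zero hq i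
  have := qPoch_self_ne_zero hq (2 * k + i)
  have := hq i; have := hq (2 * k + i)
  field_simp

/-- Bailey's lemma with both parameters sent to infinity, at the level of the kernel: put m = k + s
and c = 2k in `sum_durfee`. -/
theorem sum_baileyKernel_durfee {q : K} (hq : ∀ n : ℕ, 1 - q ^ (n + 1) ≠ 0) (M k : ℕ) :
    ∑ m ∈ Finset.range (M + 1), q ^ m ^ 2 * baileyKernel q m k * (qPoch q q (M - m))⁻¹ =
      q ^ k ^ 2 * baileyKernel q M k := by
  rcases lt_or_ge M k with h | h
  · rw [baileyKernel_of_lt q h, mul_zero]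
    refine Finset.sum_eq_zero fun m hm => ?_
    rw [baileyKernel_of_lt q (by rw [Finset.mem_range] at hm; omega)]
    simp
  · obtain ⟨S, rfl⟩ := Nat.exists_eq_add_of_le h
    rw [add_assoc, Finset.sum_range_add, Finset.sum_eq_zero, zero_add, baileyKernel_add,
      show 2 * k + S = S + 2 * k by ring, ← sum_durfee hq S (2 * k), Finset.mul_sum]
    · refine Finset.sum_congr rfl fun s _ => ?_
      rw [baileyKernel_add, show k + S - (k + s) = S - s by omega,
        show s + 2 * k = 2 * k + s by ring, mul_inv, mul_inv, mul_inv]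
      ring
    · intro m hm
      rw [baileyKernel_of_lt q (Finset.mem_range.1 hm)]
      simp

/-- Inverse relation to `sum_baileyKernel_durfee`, since 1/(q;q)_n and (-1)^n q^{n(n-1)/2}/(q;q)_n
are inverse under convolution. -/
theorem sum_baileyKernel_alternating {q : K} (hq : ∀ n : ℕ, 1 - q ^ (n + 1) ≠ 0) {m k : ℕ}
    (h : k ≤ m) :
    ∑ j ∈ Finset.range (m + 1), (-1) ^ (m - j) * q ^ ((m - j).choose 2) *
      (qPoch q q (m - j))⁻¹ * (q ^ k ^ 2 * baileyKernel q j k) =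
      q ^ m ^ 2 * baileyKernel q m k := by
  obtain ⟨N, rfl⟩ := Nat.exists_eq_add_of_le h
  rw [add_assoc, Finset.sum_range_add, Finset.sum_eq_zero, zero_add, baileyKernel_add]
  · rw [show (k + N) ^ 2 = k ^ 2 + (N ^ 2 + N * (2 * k)) by ring, pow_add, mul_assoc,
      show 2 * k + N = N + 2 * k by ring, ← sum_alternating_vandermonde hq N (2 * k),
      ← Finset.sum_range_reflect, Finset.mul_sum]
    refine Finset.sum_congr rfl fun i hi => ?_
    obtain ⟨d, rfl⟩ := Nat.exists_eq_add_of_le (Finset.mem_range_succ_iff.1 hi)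
    rw [show i + d + 1 - 1 - i = d by omega, show k + (i + d) - (k + d) = i by omega,
      show i + d - i = d by omega, baileyKernel_add, show d + 2 * k = 2 * k + d by ring,
      mul_inv, mul_inv, mul_inv]
    ring
  · intro j hj
    rw [baileyKernel_of_lt q (Finset.mem_range.1 hj)]
    simp

end Finite

/-! ### The unit Bailey pair and the cubic factor. -/

section Unit

variable {K : Type*} [Field K]

/-- The coefficients `(-1)^k q^{k(k-1)/2} (1 + q^k)`, `k ≥ 1`, of the unit Bailey pair. -/
def unitCoeff {R : Type*} [CommRing R] (q : R) (k : ℕ) : R :=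
  if k = 0 then 1 else (-1) ^ k * q ^ (k.choose 2) * (1 + q ^ k)

@[simp] theorem unitCoeff_zero {R : Type*} [CommRing R] (q : R) : unitCoeff q 0 = 1 := if_pos rfl

theorem unitCoeff_succ {R : Type*} [CommRing R] (q : R) (k : ℕ) :
    unitCoeff q (k + 1) = (-1) ^ (k + 1) * q ^ ((k + 1).choose 2) * (1 + q ^ (k + 1)) :=
  if_neg k.succ_ne_zero

/-- Isolates the only quadratic exponent as 3·C(k+1,2), so that later this power can be treated as
an opaque variable. -/
theorem unitCoeff_succ_mul_pow {R : Type*} [CommRing R] (q : R) (k : ℕ) :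
    unitCoeff q (k + 1) * q ^ (k + 1) ^ 2 =
      (-1) ^ (k + 1) * q ^ (3 * (k + 1).choose 2) * (q ^ (k + 1) * (1 + q ^ (k + 1))) := by
  have h : (k + 1).choose 2 + (k + 1) ^ 2 = 3 * (k + 1).choose 2 + (k + 1) := by
    have := Nat.div_mul_cancel (Nat.even_mul_succ_self k).two_dvd
    rw [Nat.choose_two_right, Nat.add_sub_cancel, mul_comm (k + 1)]
    nlinarith
  have h' : q ^ (k + 1).choose 2 * q ^ (k + 1) ^ 2 = q ^ (3 * (k + 1).choose 2) * q ^ (k + 1) := by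
    rw [← pow_add, ← pow_add, h]
  rw [unitCoeff_succ]
  linear_combination (-1) ^ (k + 1) * (1 + q ^ (k + 1)) * h'

/-- `(ωq; q)_n (ω⁻¹q; q)_n` for a primitive cube root of unity `ω`. -/
def qPochCubic {R : Type*} [CommRing R] (q : R) (n : ℕ) : R :=
  ∏ i ∈ Finset.range n, (1 + q ^ (i + 1) + (q ^ (i + 1)) ^ 2)

theorem qPochCubic_succ {R : Type*} [CommRing R] (q : R) (n : ℕ) :
    qPochCubic q (n + 1) = qPochCubic q n * (1 + q ^ (n + 1) + (q ^ (n + 1)) ^ 2) := by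
  simp [qPochCubic, Finset.prod_range_succ]

/-- Factorwise 1 - x³ = (1 - x)(1 + x + x²); this drives the change of base from q to q³. -/
theorem qPochCubic_mul_qPoch {R : Type*} [CommRing R] (q : R) (n : ℕ) :
    qPochCubic q n * qPoch q q n = qPoch (q ^ 3) (q ^ 3) n := by
  induction n with
  | zero => simp [qPochCubic]
  | succ n ih =>
    rw [qPochCubic_succ, qPoch_self_succ, qPoch_self_succ, ← ih]
    ring

/-- The telescoped partial sums behind the summation of `sum_unitCoeff_cubic`. -/
theorem sum_unitCoeff_cubic_partial {q : K} (hq : ∀ n : ℕ, 1 - q ^ (n + 1) ≠ 0)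
    (hQ : ∀ n, qPochCubic q n ≠ 0) (m j k : ℕ) (hj : j + 1 ≤ m) (hk : k ≤ j) :
    (1 - q ^ (j + 1)) * (1 + q ^ (m + j + 1) + (q ^ (m + j + 1)) ^ 2) *
      (∑ i ∈ Finset.range (k + 1), unitCoeff q i * q ^ i ^ 2 * baileyKernel q (j + 1) i *
        (qPochCubic q (m - i) * qPochCubic q (m + i))⁻¹) -
    (1 - q ^ (2 * m + j + 1)) *
      (∑ i ∈ Finset.range (k + 1), unitCoeff q i * q ^ i ^ 2 * baileyKernel q j i *
        (qPochCubic q (m - i) * qPochCubic q (m + i))⁻¹) =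
    q ^ (j + 1) * (-1) ^ k * q ^ (3 * (k + 1).choose 2) *
      (1 + q ^ (m - k) + (q ^ (m - k)) ^ 2) * (1 - q ^ (j + 1 - k)) * baileyKernel q (j + 1) k *
        (qPochCubic q (m - k) * qPochCubic q (m + k))⁻¹ := by
  induction k with
  | zero =>
    have h := baileyKernel_eq_mul_succ hq 0 j
    simp only [Nat.zero_add, mul_zero] at h
    simp only [Nat.zero_add, Finset.sum_range_one, unitCoeff_zero, h, Nat.sub_zero, Nat.add_zero]
    have := hQ m
    simp
    field_simp
    ring
  | succ k ih =>
    obtain ⟨i, rfl⟩ := Nat.exists_eq_add_of_le hk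
    obtain ⟨l, rfl⟩ := Nat.exists_eq_add_of_le hj
    have e0 : ∀ P R a b c d : K, P * (a + b) - R * (c + d) = P * a - R * c + (P * b - R * d) := by
      intros; ring
    rw [Finset.sum_range_succ, Finset.sum_range_succ (n := k + 1), e0, ih (by omega)]
    have e1 := baileyKernel_eq_mul_succ hq (k + 1) i
    have e2 : baileyKernel q (k + 1 + i + 1) k * (1 - q ^ (i + 2)) =
        (1 - q ^ (2 * k + 3 + i)) * baileyKernel q (k + 1 + i + 1) (k + 1) := by
      rw [add_assoc (k + 1) i 1, baileyKernel_add, show k + 1 + (i + 1) = k + (i + 2) by ring,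
        baileyKernel_add, qPoch_self_succ q (i + 1),
        show 2 * (k + 1) + (i + 1) = 2 * k + (i + 2) + 1 by ring,
        qPoch_self_succ q (2 * k + (i + 2))]
      have := qPoch_self_ne_zero hq (i + 1)
      have := qPoch_self_ne_zero hq (2 * k + (i + 2))
      have := hq (i + 1); have := hq (2 * k + (i + 2))
      field_simp
      ring
    rw [e1, unitCoeff_succ_mul_pow]
    -- All kernel values are multiples of w: the factor 1 - q^{i+2} from the induction hypothesis is
    -- what `e2` needs to convert w' without division.
    generalize baileyKernel q (k + 1 + i + 1) (k + 1) = w at *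
    generalize baileyKernel q (k + 1 + i + 1) k = w' at *
    rw [show k + 1 + i + 1 + l - k = l + i + 1 + 1 by omega,
      show k + 1 + i + 1 + l - (k + 1) = l + i + 1 by omega,
      show k + 1 + i + 1 - k = i + 2 by omega, show k + 1 + i + 1 - (k + 1) = i + 1 by omega,
      show k + 1 + i + 1 + l + (k + 1) = k + 1 + i + 1 + l + k + 1 by ring,
      qPochCubic_succ q (l + i + 1), qPochCubic_succ q (k + 1 + i + 1 + l + k),
      mul_right_comm _ (1 - q ^ (i + 2)) w', mul_assoc _ w', e2]
    have h1 := hQ (l + i + 1)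
    have h2 := hQ (k + 1 + i + 1 + l + k)
    have h3 := hQ (l + i + 1 + 1)
    have h4 := hQ (k + 1 + i + 1 + l + k + 1)
    rw [qPochCubic_succ] at h3 h4
    have h3 := right_ne_zero_of_mul h3
    have h4 := right_ne_zero_of_mul h4
    rw [Nat.choose_succ_succ' (k + 1) 1, Nat.choose_one_right]
    field_simp
    rw [mul_add 3, pow_add q (3 * (k + 1))]
    generalize q ^ (3 * (k + 1).choose 2) = z
    ring

end Unit

/-! ### Summation over n + r = m and the finite form of the double sum. -/

section Sums

variable {K : Type*} [Field K]

/-- A terminating very-well-poised `₆φ₅` summation. -/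
theorem sum_unitCoeff_cubic {q : K} (hq : ∀ n : ℕ, 1 - q ^ (n + 1) ≠ 0)
    (hQ : ∀ n, qPochCubic q n ≠ 0) (m j : ℕ) (hj : j ≤ m) :
    ∑ i ∈ Finset.range (j + 1), unitCoeff q i * q ^ i ^ 2 * baileyKernel q j i *
        (qPochCubic q (m - i) * qPochCubic q (m + i))⁻¹ =
      qPoch q q (2 * m + j) *
        (qPoch q q (2 * m) * qPoch q q j * qPochCubic q m * qPochCubic q (m + j))⁻¹ := by
  have hp := qPoch_self_ne_zero hq
  induction j with
  | zero =>
    have := hp (2 * m); have := hQ m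
    simp [baileyKernel]
    field_simp
  | succ j ih =>
    have h0 : 1 + q ^ (m + j + 1) + (q ^ (m + j + 1)) ^ 2 ≠ 0 := by
      have := hQ (m + j + 1)
      rw [qPochCubic_succ] at this
      exact right_ne_zero_of_mul this
    -- Both sides obey the same first-order recurrence in j: the boundary term of the telescoped sum
    -- at k = j cancels the extra summand i = j + 1.
    have h1 := sum_unitCoeff_cubic_partial hq hQ m j j hj le_rfl
    rw [ih (by omega)] at h1
    refine mul_left_cancel₀ (mul_ne_zero (hq j) h0) ?_
    rw [Finset.sum_range_succ, mul_add, eq_add_of_sub_eq h1, unitCoeff_succ_mul_pow]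
    obtain ⟨l, rfl⟩ := Nat.exists_eq_add_of_le hj
    have e1 := baileyKernel_add q j 1
    have e2 := baileyKernel_add q (j + 1) 0
    rw [add_zero, qPoch_zero, one_mul, show 2 * (j + 1) + 0 = 2 * j + 1 + 1 by ring,
      qPoch_self_succ] at e2
    rw [e1, e2, show 1 = 0 + 1 by rfl, qPoch_self_succ q 0]
    simp only [Nat.zero_add]
    rw [show j + 1 + l - j = l + 1 by omega, show j + 1 + l - (j + 1) = l by omega,
      show j + 1 - j = 1 by omega, qPochCubic_succ q l,
      show j + 1 + l + (j + 1) = j + 1 + l + j + 1 by ring, qPochCubic_succ q (j + 1 + l + j),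
      show 2 * (j + 1 + l) + (j + 1) = 2 * (j + 1 + l) + j + 1 by ring,
      qPoch_self_succ q (2 * (j + 1 + l) + j), qPoch_self_succ q j]
    have := hp (2 * (j + 1 + l) + j); have := hq (2 * (j + 1 + l) + j)
    have := hp j; have := hq j; have := hp (2 * j + 1); have := hq (2 * j + 1)
    have := hQ (j + 1 + l); have := hQ (j + 1 + l + j); have := hQ l
    have := hp (2 * (j + 1 + l))
    have h3 : 1 + q ^ (l + 1) + (q ^ (l + 1)) ^ 2 ≠ 0 := by
      have := hQ (l + 1)
      rw [qPochCubic_succ] at this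
      exact right_ne_zero_of_mul this
    have h4 : qPoch q q 0 = 1 := qPoch_zero q q
    have h5 : (1 : K) - q ≠ 0 := by simpa using hq 0
    rw [h4]
    simp only [pow_one, one_mul]
    generalize q ^ (3 * (j + 1).choose 2) = z
    field_simp
    ring

theorem rrExponent_eq (n r : ℕ) : rrExponent n r = 2 * (n + r) ^ 2 + n.choose 2 := by
  have h1 := two_mul_rrExponent n r
  have h2 : ((n.choose 2 : ℕ) : ℤ) * 2 = n * (n - 1) := by
    have h := Finset.sum_range_id_mul_two n
    rw [Finset.sum_range_id, ← Nat.choose_two_right] at h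
    rcases n with _ | n
    · simp
    · rw [Nat.add_sub_cancel] at h
      push_cast
      rw [add_sub_cancel_right]
      exact_mod_cast h
  zify
  nlinarith

/-- Shapes the summand so that its last factor is the closed form in `sum_unitCoeff_cubic` with m =
n + r and j = r. -/
theorem rrNum_mul_inv_rrDen {q : K} (hq : ∀ n : ℕ, 1 - q ^ (n + 1) ≠ 0)
    (hQ : ∀ n, qPochCubic q n ≠ 0) (n r : ℕ) :
    rrNum q n r * (rrDen q n r)⁻¹ = q ^ (2 * (n + r) ^ 2) *
      ((-1) ^ n * q ^ n.choose 2 * (qPoch q q n)⁻¹ * (qPoch q q (2 * (n + r) + r) *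
        (qPoch q q (2 * (n + r)) * qPoch q q r * qPochCubic q (n + r) *
          qPochCubic q (n + r + r))⁻¹)) := by
  have hp := qPoch_self_ne_zero hq
  rw [rrNum, rrDen, rrExponent_eq, ← qPochCubic_mul_qPoch, ← qPochCubic_mul_qPoch,
    show n + 2 * r = n + r + r by ring, show 2 * n + 2 * r = 2 * (n + r) by ring,
    show 2 * n + 3 * r = 2 * (n + r) + r by ring, pow_add]
  have := hp (n + r); have := hp (n + r + r); have := hp n; have := hp r
  have := hp (2 * (n + r)); have := hQ (n + r); have := hQ (n + r + r)
  field_simp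

theorem sum_range_baileyKernel_extend {R : Type*} [CommRing R] (q : R) {j m : ℕ} (h : j ≤ m)
    (f : ℕ → R) (g : ℕ → R) :
    ∑ k ∈ Finset.range (j + 1), f k * baileyKernel q j k * g k =
      ∑ k ∈ Finset.range (m + 1), f k * baileyKernel q j k * g k := by
  refine Finset.sum_subset (Finset.range_mono (by omega)) fun k _ hk => ?_
  rw [baileyKernel_of_lt q (by rw [Finset.mem_range] at hk; omega)]
  simp

theorem sum_antidiagonal_rr {q : K} (hq : ∀ n : ℕ, 1 - q ^ (n + 1) ≠ 0)
    (hQ : ∀ n, qPochCubic q n ≠ 0) (m : ℕ) :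
    ∑ p ∈ Finset.HasAntidiagonal.antidiagonal m, rrNum q p.1 p.2 * (rrDen q p.1 p.2)⁻¹ =
      ∑ k ∈ Finset.range (m + 1), unitCoeff q k * ((q ^ 3) ^ m ^ 2 * baileyKernel (q ^ 3) m k) := by
  rw [← Finset.Nat.sum_antidiagonal_swap,
    Finset.Nat.sum_antidiagonal_eq_sum_range_succ_mk]
  have h1 : ∀ j ∈ Finset.range (m + 1),
      rrNum q (j, m - j).swap.1 (j, m - j).swap.2 *
        (rrDen q (j, m - j).swap.1 (j, m - j).swap.2)⁻¹ =
      ∑ k ∈ Finset.range (m + 1), q ^ (2 * m ^ 2) * (unitCoeff q k *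
        (qPochCubic q (m - k) * qPochCubic q (m + k))⁻¹ *
        ((-1) ^ (m - j) * q ^ ((m - j).choose 2) *
          (qPoch q q (m - j))⁻¹ * (q ^ k ^ 2 * baileyKernel q j k))) := by
    intro j hj
    have hj' := Finset.mem_range_succ_iff.1 hj
    simp only [Prod.fst_swap, Prod.snd_swap]
    rw [rrNum_mul_inv_rrDen hq hQ, Nat.sub_add_cancel hj', ← sum_unitCoeff_cubic hq hQ m j hj',
      sum_range_baileyKernel_extend q hj', Finset.mul_sum, Finset.mul_sum]
    exact Finset.sum_congr rfl fun k _ => by ring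
  rw [Finset.sum_congr rfl h1, Finset.sum_comm]
  refine Finset.sum_congr rfl fun k hk => ?_
  have hk' := Finset.mem_range_succ_iff.1 hk
  rw [← Finset.mul_sum, ← Finset.mul_sum, sum_baileyKernel_alternating hq hk', baileyKernel,
    baileyKernel, if_pos hk', if_pos hk']
  -- Dividing K_q(m,k) by Q_{m-k} Q_{m+k} gives K_{q³}(m,k).
  simp only [← qPochCubic_mul_qPoch, Ring.inverse_eq_inv', mul_inv, ← pow_mul]
  rw [show 3 * m ^ 2 = 2 * m ^ 2 + m ^ 2 by ring, pow_add]
  ring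

/-- Finite form of the double sum as a theta-like single sum. -/
theorem sum_sum_antidiagonal_rr {q : K} (hq : ∀ n : ℕ, 1 - q ^ (n + 1) ≠ 0)
    (hQ : ∀ n, qPochCubic q n ≠ 0) (M : ℕ) :
    ∑ m ∈ Finset.range (M + 1), ∑ p ∈ Finset.HasAntidiagonal.antidiagonal m,
      rrNum q p.1 p.2 * (rrDen q p.1 p.2)⁻¹ * (qPoch (q ^ 3) (q ^ 3) (M - m))⁻¹ =
      ∑ k ∈ Finset.range (M + 1), unitCoeff q k * q ^ (3 * k ^ 2) * baileyKernel (q ^ 3) M k := by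
  have hq3 : ∀ n : ℕ, 1 - (q ^ 3) ^ (n + 1) ≠ 0 := fun n => by
    rw [← pow_mul]
    exact hq (3 * n + 2)
  have h1 : ∀ m ∈ Finset.range (M + 1), ∑ p ∈ Finset.HasAntidiagonal.antidiagonal m,
      rrNum q p.1 p.2 * (rrDen q p.1 p.2)⁻¹ * (qPoch (q ^ 3) (q ^ 3) (M - m))⁻¹ =
      ∑ k ∈ Finset.range (M + 1), unitCoeff q k * ((q ^ 3) ^ m ^ 2 * baileyKernel (q ^ 3) m k *
        (qPoch (q ^ 3) (q ^ 3) (M - m))⁻¹) := by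
    intro m hm
    rw [← Finset.sum_mul, sum_antidiagonal_rr hq hQ]
    have := sum_range_baileyKernel_extend (q ^ 3) (Finset.mem_range_succ_iff.1 hm)
      (fun k => unitCoeff q k * (q ^ 3) ^ m ^ 2) (fun _ => 1)
    simp only [mul_one, mul_assoc] at this
    rw [this, Finset.sum_mul]
    exact Finset.sum_congr rfl fun k _ => by ring
  rw [Finset.sum_congr rfl h1, Finset.sum_comm]
  refine Finset.sum_congr rfl fun k _ => ?_
  rw [← Finset.mul_sum, sum_baileyKernel_durfee hq3, ← pow_mul, mul_assoc]

/-! ### The finite Jacobi triple product. -/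

/-- Partial sums in the induction step of the finite Jacobi triple product. -/
theorem sum_jacobi_partial {q : K} (hq : ∀ n : ℕ, 1 - q ^ (n + 1) ≠ 0) (x y : K) (hxy : x * y = q)
    (c : ℕ → K) (hc0 : c 0 = 1)
    (hc : ∀ k, c (k + 1) = (-1) ^ (k + 1) * q ^ ((k + 1).choose 2) * (x ^ (k + 1) + y ^ (k + 1)))
    (M k : ℕ) (hk : k ≤ M) :
    (1 - q ^ (2 * M + 1)) * (1 - q ^ (2 * M + 2)) *
      (∑ i ∈ Finset.range (k + 1), c i * baileyKernel q (M + 1) i) -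
    (1 - x * q ^ M) * (1 - y * q ^ M) * (∑ i ∈ Finset.range (k + 1), c i * baileyKernel q M i) =
    (-1) ^ k * q ^ ((k + 1).choose 2) * (q ^ (M - k) * (x ^ (k + 1) + y ^ (k + 1)) * 
      baileyKernel q M k + q ^ (M + 1) * (x ^ k + y ^ k) * baileyKernel q M (k + 1)) := by
  have hp := qPoch_self_ne_zero hq
  -- Kept free of division so that it also covers i = 0, where both sides vanish.
  have hw : ∀ k i : ℕ, (1 - q ^ (2 * k + i + 1)) * baileyKernel q (k + i) (k + 1) =
      (1 - q ^ i) * baileyKernel q (k + i) k := by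
    intro k i
    rcases i with _ | i
    · rw [baileyKernel_of_lt q (by omega)]
      simp
    · rw [baileyKernel_add, show k + (i + 1) = k + 1 + i by ring, baileyKernel_add,
        show 2 * (k + 1) + i = 2 * k + (i + 1) + 1 by ring, qPoch_self_succ q i,
        qPoch_self_succ q (2 * k + (i + 1))]
      have := hp i; have := hp (2 * k + (i + 1)); have := hq i; have := hq (2 * k + (i + 1))
      field_simp
  induction k with
  | zero =>
    have h1 := baileyKernel_eq_mul_succ hq 0 M
    have h2 := hw 0 M
    have h3 : baileyKernel q (M + 1) 0 * (1 - q ^ (M + 1)) ^ 2 = baileyKernel q M 0 := by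
      simp only [Nat.zero_add, mul_zero] at h1
      rw [h1]; ring
    have h4 : baileyKernel q M 1 = (1 - q ^ M) * (1 - q ^ (M + 1)) * baileyKernel q (M + 1) 0 := by
      simp only [Nat.zero_add, mul_zero] at h2
      refine mul_left_cancel₀ (hq M) ?_
      rw [h2, ← h3]
      ring
    simp only [Nat.zero_add, Finset.sum_range_one, hc0, Nat.sub_zero, h4, ← h3]
    subst hxy
    simp
    ring
  | succ k ih =>
    obtain ⟨i, rfl⟩ := Nat.exists_eq_add_of_le hk
    have h1 := baileyKernel_eq_mul_succ hq (k + 1) i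
    have h2 : baileyKernel q (k + 1 + i) k = (1 - q ^ (2 * k + (i + 1) + 1)) *
        (1 - q ^ (2 * (k + 1) + i + 1)) * baileyKernel q (k + 1 + i + 1) (k + 1) := by
      have h := hw k (i + 1)
      rw [show k + (i + 1) = k + 1 + i by ring, h1] at h
      refine mul_left_cancel₀ (hq i) ?_
      rw [← h]
      ring
    have h3 : baileyKernel q (k + 1 + i) (k + 2) = (1 - q ^ i) * (1 - q ^ (i + 1)) *
        baileyKernel q (k + 1 + i + 1) (k + 1) := by
      have h := hw (k + 1) i
      rw [h1] at h
      refine mul_left_cancel₀ (hq (2 * (k + 1) + i)) ?_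
      rw [h]
      ring
    have e0 : ∀ P R a b c d : K, P * (a + b) - R * (c + d) = P * a - R * c + (P * b - R * d) := by
      intros; ring
    rw [Finset.sum_range_succ, Finset.sum_range_succ (n := k + 1), e0, ih (by omega), hc,
      show k + 1 + 1 = k + 2 by ring, h1, h2, h3, show k + 1 + i - k = i + 1 by omega,
      Nat.add_sub_cancel_left, Nat.choose_succ_succ' (k + 1) 1, Nat.choose_one_right]
    generalize baileyKernel q (k + 1 + i + 1) (k + 1) = w
    rw [pow_add q (k + 1) ((k + 1).choose 2)]
    generalize q ^ ((k + 1).choose 2) = z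
    -- With q replaced by x y, a polynomial identity remains.
    subst hxy
    ring

/-- Finite form of the Jacobi triple product. -/
theorem sum_jacobi {q : K} (hq : ∀ n : ℕ, 1 - q ^ (n + 1) ≠ 0) (x y : K) (hxy : x * y = q)
    (c : ℕ → K) (hc0 : c 0 = 1)
    (hc : ∀ k, c (k + 1) = (-1) ^ (k + 1) * q ^ ((k + 1).choose 2) * (x ^ (k + 1) + y ^ (k + 1)))
    (M : ℕ) :
    ∑ i ∈ Finset.range (M + 1), c i * baileyKernel q M i =
      qPoch x q M * qPoch y q M * (qPoch q q (2 * M))⁻¹ := by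
  have hp := qPoch_self_ne_zero hq
  induction M with
  | zero => simp [hc0, baileyKernel]
  | succ M ih =>
    have h := sum_jacobi_partial hq x y hxy c hc0 hc M M le_rfl
    rw [ih] at h
    refine mul_left_cancel₀ (mul_ne_zero (hq (2 * M)) (hq (2 * M + 1))) ?_
    rw [Finset.sum_range_succ, mul_add, eq_add_of_sub_eq h, hc, baileyKernel_of_lt q M.lt_succ_self]
    have e1 := baileyKernel_add q M 0
    have e2 := baileyKernel_add q (M + 1) 0
    rw [add_zero, qPoch_zero, one_mul, add_zero] at e1 e2
    rw [e1, e2, qPoch_succ, qPoch_succ, show 2 * (M + 1) = 2 * M + 1 + 1 by ring,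
      qPoch_self_succ q (2 * M + 1), qPoch_self_succ q (2 * M), Nat.sub_self]
    have := hp (2 * M); have := hq (2 * M); have := hq (2 * M + 1)
    field_simp
    ring

/-- For k ≥ 1, C(k,2) + 3k² = 7·C(k,2) + 3k, so the coefficient is (-1)^k q^{7·C(k,2)} (q^{3k} +
q^{4k}): `sum_jacobi` in base q⁷ with x = q³, y = q⁴. -/
theorem sum_unitCoeff_triple {q : K} (hq : ∀ n : ℕ, 1 - q ^ (n + 1) ≠ 0) (M : ℕ) :
    ∑ k ∈ Finset.range (M + 1), unitCoeff q k * q ^ (3 * k ^ 2) * baileyKernel (q ^ 7) M k =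
      qPoch (q ^ 3) (q ^ 7) M * qPoch (q ^ 4) (q ^ 7) M * (qPoch (q ^ 7) (q ^ 7) (2 * M))⁻¹ := by
  have hq7 : ∀ n : ℕ, 1 - (q ^ 7) ^ (n + 1) ≠ 0 := fun n => by
    rw [← pow_mul]
    exact hq (7 * n + 6)
  refine sum_jacobi hq7 _ _ (by ring) _ (by simp) (fun k => ?_) M
  have h : (k + 1).choose 2 + 3 * (k + 1) ^ 2 = 7 * (k + 1).choose 2 + 3 * (k + 1) := by
    have := Finset.sum_range_id_mul_two (k + 1)
    rw [Finset.sum_range_id, ← Nat.choose_two_right, Nat.add_sub_cancel] at this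
    nlinarith
  have h' : q ^ (k + 1).choose 2 * q ^ (3 * (k + 1) ^ 2) =
      q ^ (7 * (k + 1).choose 2) * q ^ (3 * (k + 1)) := by
    rw [← pow_add, ← pow_add, h]
  rw [unitCoeff_succ, ← pow_mul, ← pow_mul, ← pow_mul]
  linear_combination (-1) ^ (k + 1) * (1 + q ^ (k + 1)) * h'

end Sums

/-! ### From fields to domains with unit denominators. -/

section Transfer

variable {R : Type*} [CommRing R]

theorem isUnit_qPoch_pow {q : R} (hu : ∀ n : ℕ, IsUnit (1 - q ^ (n + 1))) (a : ℕ) (ha : 0 < a)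
    (n : ℕ) : IsUnit (qPoch (q ^ a) (q ^ a) n) := by
  induction n with
  | zero => simp
  | succ n ih =>
    obtain ⟨b, rfl⟩ := Nat.exists_eq_succ_of_ne_zero ha.ne'
    rw [qPoch_self_succ, ← pow_mul]
    have h := hu (b * (n + 1) + n)
    rw [show b * (n + 1) + n + 1 = b.succ * (n + 1) by rw [Nat.succ_mul]; ring] at h
    exact ih.mul h

theorem isUnit_qPoch_self {q : R} (hu : ∀ n : ℕ, IsUnit (1 - q ^ (n + 1))) (n : ℕ) :
    IsUnit (qPoch q q n) := by
  simpa using isUnit_qPoch_pow hu 1 one_pos n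

theorem isUnit_rrDen {q : R} (hu : ∀ n : ℕ, IsUnit (1 - q ^ (n + 1))) (n r : ℕ) :
    IsUnit (rrDen q n r) :=
  ((isUnit_qPoch_pow hu 3 (by norm_num) _).mul (isUnit_qPoch_pow hu 3 (by norm_num) _)).mul
    (((isUnit_qPoch_self hu _).mul (isUnit_qPoch_self hu _)).mul (isUnit_qPoch_self hu _))

theorem RingHom.map_inverse_of_isUnit {K : Type*} [Field K] (φ : R →+* K) {x : R} (hx : IsUnit x) :
    φ (Ring.inverse x) = (φ x)⁻¹ :=
  eq_inv_of_mul_eq_one_left (by rw [← map_mul, Ring.inverse_mul_cancel _ hx, map_one])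

theorem RingHom.map_qPoch {S : Type*} [CommRing S] (φ : R →+* S) (a q : R) (n : ℕ) :
    φ (qPoch a q n) = qPoch (φ a) (φ q) n := by
  simp [qPoch]

theorem RingHom.map_rrNum {S : Type*} [CommRing S] (φ : R →+* S) (q : R) (n r : ℕ) :
    φ (rrNum q n r) = rrNum (φ q) n r := by
  simp [rrNum, RingHom.map_qPoch]

theorem RingHom.map_rrDen {S : Type*} [CommRing S] (φ : R →+* S) (q : R) (n r : ℕ) :
    φ (rrDen q n r) = rrDen (φ q) n r := by
  simp [rrDen, RingHom.map_qPoch]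

theorem RingHom.map_unitCoeff {S : Type*} [CommRing S] (φ : R →+* S) (q : R) (k : ℕ) :
    φ (unitCoeff q k) = unitCoeff (φ q) k := by
  rcases k with _ | k
  · simp
  · simp [unitCoeff_succ]

theorem RingHom.map_baileyKernel {K : Type*} [Field K] (φ : R →+* K) {q : R}
    (hu : ∀ n : ℕ, IsUnit (1 - q ^ (n + 1))) (a : ℕ) (ha : 0 < a) (m k : ℕ) :
    φ (baileyKernel (q ^ a) m k) = baileyKernel (φ q ^ a) m k := by
  rw [baileyKernel, baileyKernel]
  split_ifs
  · rw [map_mul, φ.map_inverse_of_isUnit (isUnit_qPoch_pow hu a ha _),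
      φ.map_inverse_of_isUnit (isUnit_qPoch_pow hu a ha _)]
    simp [RingHom.map_qPoch]
  · exact map_zero φ

theorem RingHom.one_sub_pow_ne_zero {K : Type*} [Field K] (φ : R →+* K) {q : R}
    (hu : ∀ n : ℕ, IsUnit (1 - q ^ (n + 1))) (n : ℕ) : 1 - φ q ^ (n + 1) ≠ 0 := by
  simpa using ((hu n).map φ).ne_zero

theorem sum_sum_antidiagonal_rr_of_isUnit [IsDomain R] {q : R}
    (hu : ∀ n : ℕ, IsUnit (1 - q ^ (n + 1))) (M : ℕ) :
    ∑ m ∈ Finset.range (M + 1), ∑ p ∈ Finset.HasAntidiagonal.antidiagonal m,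
      rrNum q p.1 p.2 * Ring.inverse (rrDen q p.1 p.2) *
        Ring.inverse (qPoch (q ^ 3) (q ^ 3) (M - m)) =
      ∑ k ∈ Finset.range (M + 1), unitCoeff q k * q ^ (3 * k ^ 2) * baileyKernel (q ^ 3) M k := by
  set φ := algebraMap R (FractionRing R)
  have hq := φ.one_sub_pow_ne_zero hu
  have hQ : ∀ n, qPochCubic (φ q) n ≠ 0 := fun n h => by
    have h1 := ((isUnit_qPoch_pow hu 3 (by norm_num) n).map φ).ne_zero
    rw [φ.map_qPoch, map_pow, ← qPochCubic_mul_qPoch, h, zero_mul] at h1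
    exact h1 rfl
  apply IsFractionRing.injective R (FractionRing R)
  have h := sum_sum_antidiagonal_rr hq hQ M
  simp only [map_sum, map_mul]
  change ∑ m ∈ _, ∑ p ∈ _, φ _ * φ _ * φ _ = ∑ k ∈ _, φ _ * φ _ * φ _
  simp only [φ.map_inverse_of_isUnit (isUnit_rrDen hu _ _),
    φ.map_inverse_of_isUnit (isUnit_qPoch_pow hu 3 (by norm_num) _), RingHom.map_rrNum,
    RingHom.map_rrDen, RingHom.map_qPoch, RingHom.map_unitCoeff, map_pow,
    φ.map_baileyKernel hu 3 (by norm_num)]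
  exact h

theorem sum_unitCoeff_triple_of_isUnit [IsDomain R] {q : R}
    (hu : ∀ n : ℕ, IsUnit (1 - q ^ (n + 1))) (M : ℕ) :
    ∑ k ∈ Finset.range (M + 1), unitCoeff q k * q ^ (3 * k ^ 2) * baileyKernel (q ^ 7) M k =
      qPoch (q ^ 3) (q ^ 7) M * qPoch (q ^ 4) (q ^ 7) M *
        Ring.inverse (qPoch (q ^ 7) (q ^ 7) (2 * M)) := by
  set φ := algebraMap R (FractionRing R)
  have hq := φ.one_sub_pow_ne_zero hu
  apply IsFractionRing.injective R (FractionRing R)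
  have h := sum_unitCoeff_triple hq M
  simp only [map_sum, map_mul]
  change ∑ k ∈ _, φ _ * φ _ * φ _ = φ _ * φ _ * φ _
  simp only [φ.map_inverse_of_isUnit (isUnit_qPoch_pow hu 7 (by norm_num) _),
    RingHom.map_qPoch, RingHom.map_unitCoeff, map_pow, φ.map_baileyKernel hu 7 (by norm_num)]
  exact h

end Transfer

/-! ### The passage M → ∞. -/

section Limit

open Filter Topology

/-- A family all of whose values lie in one compact set. -/
def RangeInCompact {X α : Type*} [TopologicalSpace X] (u : α → X) : Prop := ∃ K : Set X, IsCompact K ∧ ∀ a, u a ∈ K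

namespace RangeInCompact

section Space

variable {X α β : Type*} [TopologicalSpace X] {u v : α → X}

theorem const (x : X) : RangeInCompact fun _ : α => x := ⟨{x}, isCompact_singleton, fun _ => rfl⟩

theorem comp (h : RangeInCompact u) (f : β → α) : RangeInCompact fun b => u (f b) :=
  let ⟨K, hK, hu⟩ := h
  ⟨K, hK, fun b => hu (f b)⟩

theorem ite (hu : RangeInCompact u) (hv : RangeInCompact v) (P : α → Prop) [DecidablePred P] :
    RangeInCompact fun a => if P a then u a else v a := by
  obtain ⟨K, hK, hu⟩ := hu
  obtain ⟨L, hL, hv⟩ := hv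
  refine ⟨_, hK.union hL, fun a => ?_⟩
  by_cases h : P a
  · simp [h, hu a]
  · simp [h, hv a]

theorem of_tendsto {x : ℕ → X} {a : X} (h : Tendsto x atTop (𝓝 a)) : RangeInCompact x :=
  ⟨_, h.isCompact_insert_range, fun n => Or.inr ⟨n, rfl⟩⟩

end Space

section Ring

variable {R α : Type*} [CommRing R] [TopologicalSpace R] {u v : α → R}

theorem mul [IsTopologicalRing R] (hu : RangeInCompact u) (hv : RangeInCompact v) :
    RangeInCompact fun a => u a * v a := by
  obtain ⟨K, hK, hu⟩ := hu
  obtain ⟨L, hL, hv⟩ := hv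
  exact ⟨_, (hK.prod hL).image continuous_mul, fun a => ⟨(u a, v a), ⟨hu a, hv a⟩, rfl⟩⟩

theorem add [IsTopologicalRing R] (hu : RangeInCompact u) (hv : RangeInCompact v) :
    RangeInCompact fun a => u a + v a := by
  obtain ⟨K, hK, hu⟩ := hu
  obtain ⟨L, hL, hv⟩ := hv
  exact ⟨_, (hK.prod hL).image continuous_add, fun a => ⟨(u a, v a), ⟨hu a, hv a⟩, rfl⟩⟩

theorem neg_one_pow : RangeInCompact fun n : ℕ => (-1 : R) ^ n := by
  refine ⟨{1, -1}, (Set.toFinite _).isCompact, fun n => ?_⟩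
  rcases neg_one_pow_eq_or R n with h | h <;> simp [h]

end Ring

end RangeInCompact

variable {R : Type*} [CommRing R] [TopologicalSpace R]

/-- Dominated convergence for series whose terms are `q ^ e i` times elements of a compact set. -/
def HasTannery (q : R) : Prop :=
  ∀ (ι : Type) (e : ι → ℕ), (∀ r : ℝ, 0 ≤ r → r < 1 → Summable fun i => r ^ e i) →
    ∀ (u : ℕ → ι → R) (v : ι → R), RangeInCompact (fun p : ℕ × ι => u p.1 p.2) →
      (∀ i, Tendsto (fun M => u M i) atTop (𝓝 (v i))) →
      Summable (fun i => q ^ e i * v i) ∧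
        Tendsto (fun M => ∑' i, q ^ e i * u M i) atTop (𝓝 (∑' i, q ^ e i * v i))

/-- The convergence facts on `q` from which the limiting argument proceeds. -/
structure IsConvergentBase (q : R) : Prop where
  tannery : HasTannery q
  tendsto_pow : Tendsto (fun n => q ^ n) atTop (𝓝 0)
  isUnit : ∀ n : ℕ, IsUnit (1 - q ^ (n + 1))
  tendsto_qPoch : ∀ a b : ℕ, 0 < a → 0 < b →
    Tendsto (qPoch (q ^ a) (q ^ b)) atTop (𝓝 (qPochInf (q ^ a) (q ^ b)))
  isUnit_qPochInf : ∀ a : ℕ, 0 < a → IsUnit (qPochInf (q ^ a) (q ^ a))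
  tendsto_inverse_qPoch : ∀ a : ℕ, 0 < a → Tendsto (fun n => Ring.inverse (qPoch (q ^ a) (q ^ a) n))
    atTop (𝓝 (Ring.inverse (qPochInf (q ^ a) (q ^ a))))

theorem le_rrExponent (n r : ℕ) : n + r ≤ rrExponent n r := by
  rw [rrExponent_eq]
  nlinarith [Nat.le_self_pow two_ne_zero (n + r)]

theorem summable_pow_add {r : ℝ} (h0 : 0 ≤ r) (h1 : r < 1) :
    Summable fun p : ℕ × ℕ => r ^ (p.1 + p.2) := by
  simp only [pow_add]
  have h := summable_geometric_of_lt_one h0 h1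
  exact h.mul_of_nonneg h (fun n => pow_nonneg h0 n) (fun n => pow_nonneg h0 n)

namespace IsConvergentBase

variable {q : R}

theorem rangeInCompact_pow (h : IsConvergentBase q) : RangeInCompact fun n : ℕ => q ^ n :=
  .of_tendsto h.tendsto_pow

theorem rangeInCompact_qPoch (h : IsConvergentBase q) : RangeInCompact fun n => qPoch q q n := by
  simpa using RangeInCompact.of_tendsto (h.tendsto_qPoch 1 1 one_pos one_pos)

theorem rangeInCompact_inverse_qPoch (h : IsConvergentBase q) (a : ℕ) (ha : 0 < a) :
    RangeInCompact fun n => Ring.inverse (qPoch (q ^ a) (q ^ a) n) :=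
  .of_tendsto (h.tendsto_inverse_qPoch a ha)

theorem rangeInCompact_inverse_qPoch_self (h : IsConvergentBase q) :
    RangeInCompact fun n => Ring.inverse (qPoch q q n) := by
  simpa using h.rangeInCompact_inverse_qPoch 1 one_pos

variable [IsTopologicalRing R]

/-- The general term of the double sum with `q ^ (n + r)` split off. -/
theorem exists_rr_eq_pow_mul (h : IsConvergentBase q) : ∃ g : ℕ × ℕ → R, RangeInCompact g ∧
    ∀ p : ℕ × ℕ, rrNum q p.1 p.2 * Ring.inverse (rrDen q p.1 p.2) = q ^ (p.1 + p.2) * g p := by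
  have i3 := h.rangeInCompact_inverse_qPoch 3 (by norm_num)
  have i1 := h.rangeInCompact_inverse_qPoch_self
  have p1 := h.rangeInCompact_qPoch
  refine ⟨_, (((RangeInCompact.neg_one_pow.comp fun p : ℕ × ℕ => p.1).mul
    (h.rangeInCompact_pow.comp fun p : ℕ × ℕ => rrExponent p.1 p.2 - (p.1 + p.2))).mul
    (((p1.comp fun p : ℕ × ℕ => p.1 + p.2).mul (p1.comp fun p : ℕ × ℕ => p.1 + 2 * p.2)).mul
      (p1.comp fun p : ℕ × ℕ => 2 * p.1 + 3 * p.2))).mul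
    (((i3.comp fun p : ℕ × ℕ => p.1 + p.2).mul (i3.comp fun p : ℕ × ℕ => p.1 + 2 * p.2)).mul
      (((i1.comp fun p : ℕ × ℕ => p.1).mul (i1.comp fun p : ℕ × ℕ => p.2)).mul
        (i1.comp fun p : ℕ × ℕ => 2 * p.1 + 2 * p.2))), fun p => ?_⟩
  have he : q ^ rrExponent p.1 p.2 =
      q ^ (p.1 + p.2) * q ^ (rrExponent p.1 p.2 - (p.1 + p.2)) := by
    rw [← pow_add, Nat.add_sub_cancel' (le_rrExponent _ _)]
  rw [rrNum, rrDen, he]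
  simp only [Ring.mul_inverse_rev]
  ring

theorem exists_unitCoeff_eq_pow_mul (h : IsConvergentBase q) : ∃ g : ℕ → R, RangeInCompact g ∧
    ∀ k : ℕ, unitCoeff q k * q ^ (3 * k ^ 2) = q ^ k * g k := by
  refine ⟨_, ((RangeInCompact.const 1).ite (((RangeInCompact.neg_one_pow).mul
    (h.rangeInCompact_pow.comp fun k => k.choose 2)).mul
    ((RangeInCompact.const 1).add h.rangeInCompact_pow)) (fun k => k = 0)).mul
    (h.rangeInCompact_pow.comp fun k => 3 * k ^ 2 - k), fun k => ?_⟩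
  have he : q ^ (3 * k ^ 2) = q ^ k * q ^ (3 * k ^ 2 - k) := by
    rw [← pow_add, Nat.add_sub_cancel']
    nlinarith [Nat.le_self_pow two_ne_zero k]
  rw [unitCoeff, he]
  ring

/-- For fixed k the kernel tends to 1/(q^a;q^a)_∞², and its values lie in a compact set, so the
limit may be taken termwise. -/
theorem tendsto_sum_unitCoeff [T2Space R] (h : IsConvergentBase q) (a : ℕ) (ha : 0 < a) :
    Tendsto (fun M => ∑ k ∈ Finset.range (M + 1),
      unitCoeff q k * q ^ (3 * k ^ 2) * baileyKernel (q ^ a) M k) atTop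
      (𝓝 ((∑' k, unitCoeff q k * q ^ (3 * k ^ 2)) *
        Ring.inverse (qPochInf (q ^ a) (q ^ a)) ^ 2)) := by
  obtain ⟨g, hg, hgq⟩ := h.exists_unitCoeff_eq_pow_mul
  have hi := h.rangeInCompact_inverse_qPoch a ha
  have hexp : ∀ r : ℝ, 0 ≤ r → r < 1 → Summable fun i : ℕ => r ^ (id i) :=
    fun r h0 h1 => summable_geometric_of_lt_one h0 h1
  have hsum := (h.tannery ℕ id hexp (fun _ => g) g (hg.comp Prod.snd)
    fun i => tendsto_const_nhds).1
  have hlim := (h.tannery ℕ id hexp (fun M k => g k * baileyKernel (q ^ a) M k)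
    (fun k => g k * Ring.inverse (qPochInf (q ^ a) (q ^ a)) ^ 2)
    ((hg.comp Prod.snd).mul (((hi.comp fun p : ℕ × ℕ => p.1 - p.2).mul
      (hi.comp fun p : ℕ × ℕ => p.1 + p.2)).ite (RangeInCompact.const 0) _)) fun k => ?_).2
  · simp only [id, ← mul_assoc, ← hgq] at hlim hsum
    rw [hsum.tsum_mul_right] at hlim
    refine hlim.congr fun M => ?_
    refine tsum_eq_sum fun k hk => ?_
    rw [baileyKernel_of_lt _ (by rw [Finset.mem_range] at hk; omega), mul_zero]
  · refine tendsto_const_nhds.mul ?_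
    have ht := h.tendsto_inverse_qPoch a ha
    rw [sq]
    refine ((ht.comp (tendsto_sub_atTop_nat k)).mul
      (ht.comp (tendsto_add_atTop_nat k))).congr' ?_
    filter_upwards [eventually_ge_atTop k] with M hM
    rw [baileyKernel, if_pos hM]
    rfl

theorem tsum_unitCoeff [T2Space R] [IsDomain R] (h : IsConvergentBase q) :
    ∑' k, unitCoeff q k * q ^ (3 * k ^ 2) = rrProd q := by
  have h1 := h.tendsto_sum_unitCoeff 7 (by norm_num)
  simp only [sum_unitCoeff_triple_of_isUnit h.isUnit] at h1
  have h2 := ((h.tendsto_qPoch 3 7 (by norm_num) (by norm_num)).mul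
    (h.tendsto_qPoch 4 7 (by norm_num) (by norm_num))).mul
    ((h.tendsto_inverse_qPoch 7 (by norm_num)).comp
      (tendsto_id.const_mul_atTop' (two_pos : 0 < 2)))
  have h3 := tendsto_nhds_unique h1 h2
  have hu := h.isUnit_qPochInf 7 (by norm_num)
  have hc := Ring.inverse_mul_cancel _ hu
  rw [rrProd]
  generalize Ring.inverse (qPochInf (q ^ 7) (q ^ 7)) = i at *
  generalize qPochInf (q ^ 7) (q ^ 7) = P at *
  generalize (∑' k, unitCoeff q k * q ^ (3 * k ^ 2)) = S at *
  -- `h3` says S i² = (q³;q⁷)_∞ (q⁴;q⁷)_∞ i; multiply by P² and use i P = 1.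
  linear_combination P ^ 2 * h3 + (qPochInf (q ^ 3) (q ^ 7) * qPochInf (q ^ 4) (q ^ 7) * P -
    S * (i * P + 1)) * hc

theorem hasSum_rr [T2Space R] [IsDomain R] (h : IsConvergentBase q) :
    HasSum (fun p : ℕ × ℕ => rrNum q p.1 p.2 * Ring.inverse (rrDen q p.1 p.2))
      (rrProd q * Ring.inverse (qPochInf (q ^ 3) (q ^ 3))) := by
  obtain ⟨g, hg, hgq⟩ := h.exists_rr_eq_pow_mul
  have ht := h.tendsto_inverse_qPoch 3 (by norm_num)
  have hi := h.rangeInCompact_inverse_qPoch 3 (by norm_num)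
  have hsum := (h.tannery (ℕ × ℕ) (fun p => p.1 + p.2) (fun r => summable_pow_add)
    (fun _ => g) g (hg.comp Prod.snd) fun i => tendsto_const_nhds).1
  have hlim := (h.tannery (ℕ × ℕ) (fun p => p.1 + p.2) (fun r => summable_pow_add)
    (fun M p => g p * if p.1 + p.2 ≤ M then
      Ring.inverse (qPoch (q ^ 3) (q ^ 3) (M - (p.1 + p.2))) else 0)
    (fun p => g p * Ring.inverse (qPochInf (q ^ 3) (q ^ 3)))
    ((hg.comp Prod.snd).mul ((hi.comp fun p : ℕ × ℕ × ℕ => p.1 - (p.2.1 + p.2.2)).ite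
      (RangeInCompact.const 0) _)) fun p => ?_).2
  · simp only [← mul_assoc, ← hgq] at hlim hsum
    rw [hsum.tsum_mul_right] at hlim
    -- The cutoff n + r ≤ M makes the series finite; grouped by m = n + r it is the finite identity.
    have hfin : ∀ M, ∑' p : ℕ × ℕ, rrNum q p.1 p.2 * Ring.inverse (rrDen q p.1 p.2) *
        (if p.1 + p.2 ≤ M then Ring.inverse (qPoch (q ^ 3) (q ^ 3) (M - (p.1 + p.2))) else 0) =
        ∑ k ∈ Finset.range (M + 1),
          unitCoeff q k * q ^ (3 * k ^ 2) * baileyKernel (q ^ 3) M k := by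
      intro M
      rw [← sum_sum_antidiagonal_rr_of_isUnit h.isUnit, tsum_eq_sum
        (s := (Finset.range (M + 1)).biUnion Finset.HasAntidiagonal.antidiagonal),
        Finset.sum_biUnion]
      · refine Finset.sum_congr rfl fun m hm => Finset.sum_congr rfl fun p hp => ?_
        rw [Finset.HasAntidiagonal.mem_antidiagonal] at hp
        rw [hp, if_pos (Finset.mem_range_succ_iff.1 hm)]
      · exact fun i _ j _ hij => Finset.disjoint_left.2 fun p hp hp' => hij <| by
          rw [Finset.HasAntidiagonal.mem_antidiagonal] at hp hp'
          rw [← hp, hp']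
      · intro p hp
        rw [if_neg, mul_zero]
        intro hle
        exact hp (Finset.mem_biUnion.2 ⟨p.1 + p.2, Finset.mem_range_succ_iff.2 hle,
          Finset.HasAntidiagonal.mem_antidiagonal.2 rfl⟩)
    simp only [hfin] at hlim
    have h3 := tendsto_nhds_unique hlim (h.tendsto_sum_unitCoeff 3 (by norm_num))
    rw [h.tsum_unitCoeff, sq, ← mul_assoc] at h3
    have hu := (h.isUnit_qPochInf 3 (by norm_num)).ringInverse
    -- Both limits carry a factor 1/(q³;q³)_∞, the theta side twice; one copy cancels.
    rw [← hu.mul_right_cancel h3]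
    exact hsum.hasSum
  · refine tendsto_const_nhds.mul ((ht.comp (tendsto_sub_atTop_nat (p.1 + p.2))).congr' ?_)
    filter_upwards [eventually_ge_atTop (p.1 + p.2)] with M hM
    rw [if_pos hM]
    rfl

end IsConvergentBase

end Limit

/-! ### Complex q in the unit disc. -/

section Complex

open Filter Topology

theorem hasTannery_complex {q : ℂ} (hq : ‖q‖ < 1) : HasTannery q := by
  intro ι e he u v ⟨K, hK, hu⟩ huv
  obtain ⟨C, hC⟩ := hK.isBounded.exists_norm_le
  have hb : Summable fun i => ‖q‖ ^ e i * C := (he ‖q‖ (norm_nonneg q) hq).mul_right C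
  have hterm : ∀ (x : ℂ) (i : ι), ‖x‖ ≤ C → ‖q ^ e i * x‖ ≤ ‖q‖ ^ e i * C := fun x i hx => by
    rw [norm_mul, norm_pow]
    exact mul_le_mul_of_nonneg_left hx (by positivity)
  refine ⟨Summable.of_norm_bounded hb fun i => hterm _ i ?_,
    tendsto_tsum_of_dominated_convergence hb (fun i => (huv i).const_mul _)
      (Eventually.of_forall fun M i => hterm _ i (hC _ (hu (M, i))))⟩
  exact le_of_tendsto (huv i).norm (Eventually.of_forall fun M => hC _ (hu (M, i)))

theorem isConvergentBase_complex {q : ℂ} (hq : ‖q‖ < 1) : IsConvergentBase q := by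
  have hne : ∀ n : ℕ, 1 - q ^ (n + 1) ≠ 0 := fun n h => by
    have h1 : ‖q ^ (n + 1)‖ < 1 := by
      rw [norm_pow]
      exact pow_lt_one₀ (norm_nonneg q) hq n.succ_ne_zero
    rw [← sub_eq_zero.1 h, norm_one] at h1
    exact lt_irrefl _ h1
  have hs : ∀ a b : ℕ, 0 < b → Summable fun j : ℕ => ‖-(q ^ a * (q ^ b) ^ j)‖ := fun a b hb => by
    simp only [norm_neg, norm_mul, norm_pow]
    exact (summable_geometric_of_lt_one (by positivity)
      (pow_lt_one₀ (norm_nonneg q) hq hb.ne')).mul_left _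
  have ht : ∀ a b : ℕ, 0 < a → 0 < b →
      Tendsto (qPoch (q ^ a) (q ^ b)) atTop (𝓝 (qPochInf (q ^ a) (q ^ b))) := fun a b _ hb => by
    have h := (multipliable_one_add_of_summable (hs a b hb)).hasProd.tendsto_prod_nat
    simp only [← sub_eq_add_neg] at h
    exact h
  have hnz : ∀ a : ℕ, 0 < a → qPochInf (q ^ a) (q ^ a) ≠ 0 := fun a ha => by
    have h := tprod_one_add_ne_zero_of_summable (f := fun j : ℕ => -(q ^ a * (q ^ a) ^ j))
      (fun j => ?_) (hs a a ha)
    · simp only [← sub_eq_add_neg] at h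
      exact h
    · obtain ⟨b, rfl⟩ := Nat.exists_eq_succ_of_ne_zero ha.ne'
      rw [← sub_eq_add_neg, ← pow_succ', ← pow_mul,
        show b.succ * (j + 1) = b * (j + 1) + j + 1 by rw [Nat.succ_mul]; ring]
      exact hne _
  exact
    { tannery := hasTannery_complex hq
      tendsto_pow := tendsto_pow_atTop_nhds_zero_of_norm_lt_one hq
      isUnit := fun n => (hne n).isUnit
      tendsto_qPoch := ht
      isUnit_qPochInf := fun a ha => (hnz a ha).isUnit
      tendsto_inverse_qPoch := fun a ha => by
        simp only [Ring.inverse_eq_inv']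
        exact (ht a a ha ha).inv₀ (hnz a ha) }

end Complex

/-! ### The formal variable over ℤ. -/

section Formal

open Filter Topology PowerSeries

/-- Terms of a summable family tend to zero along the cofinite filter, so only finitely many are at
least (1/2)^d. Each coefficient of the formal series is thus a finite sum. -/
theorem finite_setOf_le_of_summable_pow {ι : Type*} (e : ι → ℕ)
    (he : Summable fun i => (1 / 2 : ℝ) ^ e i) (d : ℕ) : {i | e i ≤ d}.Finite := by
  have h := he.tendsto_cofinite_zero.eventually (gt_mem_nhds (by positivity : (0 : ℝ) < (1 / 2) ^ d))
  refine Set.Finite.subset (eventually_cofinite.1 h) fun i hi => ?_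
  simp only [Set.mem_ofPred_eq, not_lt] at hi ⊢
  exact pow_le_pow_of_le_one (by norm_num) (by norm_num) hi

theorem hasSum_X_pow_mul {ι : Type*} (e : ι → ℕ) (he : ∀ d, {i | e i ≤ d}.Finite)
    (w : ι → ℤ⟦X⟧) :
    HasSum (fun i => (X : ℤ⟦X⟧) ^ e i * w i)
      (PowerSeries.mk fun d => ∑ i ∈ (he d).toFinset, coeff d ((X : ℤ⟦X⟧) ^ e i * w i)) := by
  rw [WithPiTopology.hasSum_iff_hasSum_coeff]
  intro d
  rw [coeff_mk]
  refine hasSum_sum_of_ne_finset_zero fun i hi => ?_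
  rw [coeff_X_pow_mul', if_neg]
  simpa using hi

theorem hasTannery_X : HasTannery (X : ℤ⟦X⟧) := by
  intro ι e he u v _ huv
  have hf := finite_setOf_le_of_summable_pow e (he (1 / 2) (by norm_num) (by norm_num))
  refine ⟨(hasSum_X_pow_mul e hf v).summable, ?_⟩
  simp only [(hasSum_X_pow_mul e hf _).tsum_eq]
  rw [WithPiTopology.tendsto_iff_coeff_tendsto]
  intro d
  simp only [coeff_mk]
  refine tendsto_finsetSum _ fun i _ => ?_
  exact ((WithPiTopology.continuous_coeff ℤ d).tendsto _).comp ((huv i).const_mul _)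

theorem tendsto_ringInverse_powerSeries {x : ℕ → ℤ⟦X⟧} {y : ℤ⟦X⟧} (hx : ∀ n, IsUnit (x n))
    (hy : IsUnit y) (h : Tendsto x atTop (𝓝 y)) :
    Tendsto (fun n => Ring.inverse (x n)) atTop (𝓝 (Ring.inverse y)) := by
  rw [WithPiTopology.tendsto_iff_coeff_tendsto] at h ⊢
  intro d
  -- As ℤ is discrete, the coefficients up to d are eventually equal; then 1/y - 1/x_n = (x_n -
  -- y)/(x_n y) is divisible by X^{d+1}.
  have hev : ∀ᶠ n in atTop, ∀ k ∈ Finset.range (d + 1), coeff k (x n) = coeff k y := by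
    rw [Filter.eventually_all_finset]
    intro k _
    simpa only [nhds_discrete, tendsto_pure] using h k
  refine tendsto_const_nhds.congr' ?_
  filter_upwards [hev] with n hn
  have hdvd : (X : ℤ⟦X⟧) ^ (d + 1) ∣ x n - y := by
    rw [X_pow_dvd_iff]
    intro k hk
    rw [map_sub, hn k (Finset.mem_range.2 hk), sub_self]
  have heq : Ring.inverse y - Ring.inverse (x n) =
      (x n - y) * (Ring.inverse y * Ring.inverse (x n)) := by
    linear_combination (-Ring.inverse y) * (Ring.mul_inverse_cancel _ (hx n)) +
      Ring.inverse (x n) * (Ring.mul_inverse_cancel _ hy)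
  have h0 := X_pow_dvd_iff.1 (heq ▸ hdvd.mul_right (Ring.inverse y * Ring.inverse (x n))) d
    (Nat.lt_succ_self d)
  rwa [map_sub, sub_eq_zero] at h0

theorem isConvergentBase_X : IsConvergentBase (X : ℤ⟦X⟧) := by
  have hu : ∀ n : ℕ, IsUnit (1 - (X : ℤ⟦X⟧) ^ (n + 1)) := fun n => by
    rw [isUnit_iff_constantCoeff]
    simp
  have ht : ∀ a b : ℕ, 0 < a → 0 < b → Tendsto (qPoch ((X : ℤ⟦X⟧) ^ a) (X ^ b)) atTop
      (𝓝 (qPochInf (X ^ a) (X ^ b))) := fun a b _ hb => by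
    have h := (WithPiTopology.multipliable_one_add_of_tendsto_order_atTop_nhds_top ℤ
      (f := fun j : ℕ => -((X : ℤ⟦X⟧) ^ a * (X ^ b) ^ j)) ?_).hasProd.tendsto_prod_nat
    · simp only [← sub_eq_add_neg] at h
      exact h
    · refine ENat.tendsto_nhds_top_iff_natCast_lt.2 fun n => ?_
      filter_upwards [eventually_gt_atTop n] with j hj
      rw [order_neg, ← pow_mul, ← pow_add, order_X_pow]
      exact_mod_cast by nlinarith
  have hun : ∀ a : ℕ, 0 < a → IsUnit (qPochInf ((X : ℤ⟦X⟧) ^ a) (X ^ a)) := fun a ha => by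
    have h1 := ((WithPiTopology.continuous_constantCoeff ℤ).tendsto _).comp (ht a a ha ha)
    have h2 : ∀ n, constantCoeff (qPoch ((X : ℤ⟦X⟧) ^ a) (X ^ a) n) = 1 := fun n => by
      simp [qPoch, ha.ne']
    rw [isUnit_iff_constantCoeff, tendsto_nhds_unique h1
      (tendsto_const_nhds.congr fun n => (h2 n).symm)]
    exact isUnit_one
  exact
    { tannery := hasTannery_X
      tendsto_pow := by
        rw [WithPiTopology.tendsto_iff_coeff_tendsto]
        intro d
        refine tendsto_const_nhds.congr' ?_
        filter_upwards [eventually_gt_atTop d] with n hn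
        rw [coeff_X_pow, if_neg hn.ne, map_zero]
      isUnit := hu
      tendsto_qPoch := ht
      isUnit_qPochInf := hun
      tendsto_inverse_qPoch := fun a ha => tendsto_ringInverse_powerSeries
        (isUnit_qPoch_pow hu a ha) (hun a ha) (ht a a ha ha) }

end Formal

theorem mainTheorem10 :
    (∀ q : ℂ, ‖q‖ < 1 →
      HasSum (fun p : ℕ × ℕ => rrNum q p.1 p.2 / rrDen q p.1 p.2)
        (rrProd q / qPochInf (q ^ 3) (q ^ 3))) ∧
    HasSum
      (fun p : ℕ × ℕ =>
        rrNum (PowerSeries.X : ℤ⟦X⟧) p.1 p.2 *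
          Ring.inverse (rrDen (PowerSeries.X : ℤ⟦X⟧) p.1 p.2))
      (rrProd (PowerSeries.X : ℤ⟦X⟧) *
        Ring.inverse (qPochInf ((PowerSeries.X : ℤ⟦X⟧) ^ 3) (PowerSeries.X ^ 3))) := by
  refine ⟨fun q hq => ?_, isConvergentBase_X.hasSum_rr⟩
  have h := (isConvergentBase_complex hq).hasSum_rr
  simp only [Ring.inverse_eq_inv', ← div_eq_mul_inv] at h
  exact h
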